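/- Let $\theta$ be irrational, let $A_\theta$ be the C*-algebra generated by two unitaries $U,V$ with $UV=e^{2\pi i\theta}VU$, let $\alpha_s(U^nV^m)=e^{i(s_1n+s_2m)}U^nV^m$ ($s\in\mathbb R^2$), let $A_\theta^\infty$ be the algebra of all $a\in A_\theta$ for which $s\mapsto\alpha_s(a)$ is smooth, and let $\delta_j(a)=-i\,\partial_{s_j}\alpha_s(a)|_{s=0}$ ($j=1,2$), so that $\delta_1U=U$, $\delta_1V=0$, $\delta_2U=0$, $\delta_2V=V$. Let $h=h^*\in A_\theta^\infty$, $k=e^{h/2}$ and $\triangle=\delta_1^2+\delta_2^2$. For a parameter $u>0$ the operator $k\triangle k+u$ has the symbol $a_2+a_1+a_0$ with $$a_2=k^2|\xi|^2+u,\qquad a_1=\sum_i 2\xi_i\,k\delta_i(k),\qquad a_0=\sum_i k\delta_i^2(k)\qquad(\xi\in\mathbb R^2).$$ Let $\sum_{j\ge 0}b_j(\xi,u)$ be a formal inverse of it in the algebra of symbols: each $b_j$ is a smooth function of $(\xi,u)\in\mathbb R^2\times(0,\infty)$ with values in $A_\theta^\infty$, $b_j(t\xi,t^2u)=t^{-2-j}b_j(\xi,u)$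 for $t>0$, and, for every $n\ge 0$, $$\sum_{j+(2-m)+l_1+l_2=n}\frac1{l_1!\,l_2!}\,\partial_{\xi_1}^{l_1}\partial_{\xi_2}^{l_2}(b_j)\,\delta_1^{l_1}\delta_2^{l_2}(a_m)=\begin{cases}1,&n=0,\\0,&n\ge1.\end{cases}$$ Write $b_j(\xi)=b_j(\xi,1)$, so that $\sum_j b_j(\xi)$ corresponds to the operator $k\triangle k+1$. Then $b_0(\xi)=(k^2r^2+1)^{-1}$ for $|\xi|=r$; write $b_0=(k^2r^2+1)^{-1}$. The function $b_2$ is integrable on $\mathbb R^2$, the function $r\mapsto T(r)\,b_0\,r$ is integrable on $(0,\infty)$, and $$\int_{\mathbb R^2} b_2(\xi_1,\xi_2)\,d\xi_1\,d\xi_2=2\pi\int_0^\infty T(r)\,b_0\,r\,dr ,$$ where $$\begin{aligned} T(r)=\sum_{i=1,2}\Big(&-b_0k\delta_i^2(k)+3r^2k^3b_0^2\delta_i^2(k)+4r^2k^2b_0^2\delta_i(k)\delta_i(k)+r^2k^2b_0^2\delta_i^2(k)k\\ &-2r^4k^5b_0^3\delta_i^2(k)-4r^4k^4b_0^3\delta_i(k)\delta_i(k)-2r^4k^4b_0^3\delta_i^2(k)k\\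 &+r^2kb_0\delta_i(k)b_0\big(4k\delta_i(k)+2\delta_i(k)k\big)-2r^4kb_0\delta_i(k)k^2b_0^2\big(k\delta_i(k)+\delta_i(k)k\big)\\ &-r^4k^3b_0^2\delta_i(k)b_0\big(8k\delta_i(k)+6\delta_i(k)k\big)+2r^6k^3b_0^2\delta_i(k)k^2b_0^2\big(k\delta_i(k)+\delta_i(k)k\big)\\ &-r^4k^2b_0^2\delta_i(k)kb_0\big(6k\delta_i(k)+4\delta_i(k)k\big)+2r^6k^2b_0^2\delta_i(k)k^3b_0^2\big(k\delta_i(k)+\delta_i(k)k\big)\\ &+4r^6k^5b_0^3\delta_i(k)b_0\big(k\delta_i(k)+\delta_i(k)k\big)+4r^6k^4b_0^3\delta_i(k)kb_0\big(k\delta_i(k)+\delta_i(k)k\big)\Big). \end{aligned}$$ -/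

import Mathlib

open scoped ContDiff
open MeasureTheory Set

noncomputable section

namespace NCTorus

/-! ### The irrational rotation algebra, its torus action and its derivations -/

/-- The Hilbert space `ℓ²(ℤ²)`. -/
abbrev Hilb : Type := lp (fun _ : ℤ × ℤ => ℂ) 2

/-- The C⋆-algebra of bounded operators on `ℓ²(ℤ²)`, in which the noncommutative torus is
realised (as the norm closed ⋆-subalgebra generated by two unitaries). -/
abbrev Op : Type := Hilb →L[ℂ] Hilb

theorem memlp_wshift {c : ℤ × ℤ → ℂ} (hc : ∀ x, ‖c x‖ = 1) (v : ℤ × ℤ) (f : Hilb) :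
    Memℓp (fun x => c x * f (x - v)) 2 := by
  refine memℓp_gen ?_
  have hf := (lp.memℓp f).summable (by norm_num)
  have := ((Equiv.subRight v).summable_iff).2 hf
  simpa [Function.comp_def, norm_mul, hc] using this

/-- The weighted shift `(wshift c v f)(x) = c(x) f(x - v)` on `ℓ²(ℤ²)`, with `|c| = 1`. -/
def wshift (c : ℤ × ℤ → ℂ) (hc : ∀ x, ‖c x‖ = 1) (v : ℤ × ℤ) : Op :=
  LinearMap.mkContinuous
    { toFun := fun f => ⟨fun x => c x * f (x - v), memlp_wshift hc v f⟩
      map_add' := fun f g => by ext x; exact mul_add _ _ _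
      map_smul' := fun a f => by ext x; exact mul_left_comm _ _ _ }
    1
    (fun f => by
      have h2 : (0 : ℝ) < (2 : ENNReal).toReal := by norm_num
      rw [one_mul, lp.norm_eq_tsum_rpow h2, lp.norm_eq_tsum_rpow h2]
      refine le_of_eq ?_
      congr 1
      have := (Equiv.subRight v).tsum_eq (fun x => ‖f x‖ ^ (2 : ENNReal).toReal)
      simpa [norm_mul, hc] using this)

@[simp]
theorem wshift_apply (c : ℤ × ℤ → ℂ) (hc : ∀ x, ‖c x‖ = 1) (v : ℤ × ℤ) (f : Hilb) (x : ℤ × ℤ) :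
    wshift c hc v f x = c x * f (x - v) := rfl

/-- The unitary `U`, with `U e_{n,m} = e_{n+1,m}`. -/
def U : Op := wshift (fun _ => 1) (fun _ => norm_one) (1, 0)

/-- The unitary `V`, with `V e_{n,m} = exp(-2πi n θ) e_{n,m+1}`. -/
def V (θ : ℝ) : Op :=
  wshift (fun x => Complex.exp ((-(2 * Real.pi * x.1 * θ) : ℝ) * Complex.I))
    (fun _ => Complex.norm_exp_ofReal_mul_I _) (0, 1)

theorem U_mul_V (θ : ℝ) :
    U * V θ = Complex.exp (2 * Real.pi * Complex.I * θ) • (V θ * U) := by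
  ext f x
  simp only [U, V, mul_apply_eq_comp, wshift_apply, smul_apply,
    lp.coeFn_smul, Pi.smul_apply, smul_eq_mul, one_mul]
  rw [← mul_assoc, ← Complex.exp_add, sub_right_comm]
  congr 2
  push_cast [Prod.fst_sub]
  ring

/-- The rotation algebra `A_θ`: the C⋆-algebra generated by the two unitaries `U`, `V`
with `U V = exp(2πiθ) V U`. -/
def algebra (θ : ℝ) : StarSubalgebra ℂ Op :=
  (StarAlgebra.adjoin ℂ ({U, V θ} : Set Op)).topologicalClosure

/-- The diagonal unitary `W_s e_{n,m} = exp(i(s₁ n + s₂ m)) e_{n,m}`. -/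
def W (s : ℝ × ℝ) : Op :=
  wshift (fun x => Complex.exp ((s.1 * x.1 + s.2 * x.2 : ℝ) * Complex.I))
    (fun _ => Complex.norm_exp_ofReal_mul_I _) 0

theorem W_zero : W 0 = 1 := by
  ext f x
  simp [W]

theorem W_add (s t : ℝ × ℝ) : W (s + t) = W s * W t := by
  ext f x
  simp only [W, mul_apply_eq_comp, wshift_apply, sub_zero]
  rw [← mul_assoc, ← Complex.exp_add]
  congr 2
  push_cast [Prod.fst_add, Prod.snd_add]
  ring

/-- The action of `ℝ²` (through `𝕋² = (ℝ / 2πℤ)²`) by automorphisms,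
`α_s(Uⁿ Vᵐ) = exp(i(s₁ n + s₂ m)) Uⁿ Vᵐ`, implemented as `α_s(a) = W_s a W_s⁻¹`. -/
def act (s : ℝ × ℝ) (a : Op) : Op := W s * a * W (-s)

theorem W_neg_mul (s : ℝ × ℝ) : W (-s) * W s = 1 := by
  rw [← W_add, neg_add_cancel, W_zero]

theorem act_mul (s : ℝ × ℝ) (a b : Op) : act s (a * b) = act s a * act s b := by
  have h : act s a * act s b = W s * a * (W (-s) * W s) * b * W (-s) := by
    simp only [act, mul_assoc]
  rw [h, W_neg_mul, mul_one, act, ← mul_assoc]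

theorem act_add (s t : ℝ × ℝ) (a : Op) : act (s + t) a = act s (act t a) := by
  rw [act, act, act, neg_add_rev, W_add, W_add]
  simp only [mul_assoc]

theorem act_zero (a : Op) : act 0 a = a := by simp [act, W_zero]

theorem act_U (s : ℝ × ℝ) : act s U = Complex.exp (s.1 * Complex.I) • U := by
  ext f x
  simp only [act, U, W, mul_apply_eq_comp, wshift_apply, sub_zero, one_mul,
    smul_apply, lp.coeFn_smul, Pi.smul_apply, smul_eq_mul]
  rw [← mul_assoc, ← Complex.exp_add]
  congr 2
  push_cast [Prod.fst_sub, Prod.snd_sub, Prod.fst_neg, Prod.snd_neg]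
  ring

theorem act_V (θ : ℝ) (s : ℝ × ℝ) : act s (V θ) = Complex.exp (s.2 * Complex.I) • V θ := by
  ext f x
  simp only [act, V, W, mul_apply_eq_comp, wshift_apply, sub_zero,
    smul_apply, lp.coeFn_smul, Pi.smul_apply, smul_eq_mul]
  rw [← mul_assoc, ← mul_assoc, ← mul_assoc, ← Complex.exp_add, ← Complex.exp_add,
    ← Complex.exp_add]
  congr 2
  push_cast [Prod.fst_sub, Prod.snd_sub, Prod.fst_neg, Prod.snd_neg]
  ring

/-- The smooth subalgebra `A_θ^∞`: the elements `a` of `A_θ` for which `s ↦ α_s(a)` is smooth. -/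
def smooth (θ : ℝ) : Set Op :=
  {a | a ∈ algebra θ ∧ ContDiff ℝ ∞ (fun s : ℝ × ℝ => act s a)}

/-- The standard basis of `ℝ²`. -/
def stdVec : Fin 2 → ℝ × ℝ := ![(1, 0), (0, 1)]

/-- The two derivations `δ₁, δ₂` (indexed by `Fin 2`): `δ_j(a) = -i (∂/∂s_j) α_s(a)` at `s = 0`,
so that `δ₁ U = U`, `δ₁ V = 0`, `δ₂ U = 0`, `δ₂ V = V`. -/
def δ (j : Fin 2) (a : Op) : Op :=
  (-Complex.I) • lineDeriv ℝ (fun s : ℝ × ℝ => act s a) 0 (stdVec j)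

/-! ### Symbols with a parameter -/

/-- A function of the covariable `ξ ∈ ℝ²` and of a parameter `u > 0` with values in operators. -/
abbrev Sym : Type := ℝ × ℝ → ℝ → Op

/-- The partial derivative `∂/∂ξ_j`. -/
def pd (j : Fin 2) (f : ℝ × ℝ → Op) : ℝ × ℝ → Op := fun ξ => lineDeriv ℝ f ξ (stdVec j)

/-- `f` is a homogeneous symbol of order `d` with parameter: it takes values in `A_θ^∞`, it is
smooth as a map to the Fréchet space `A_θ^∞` (that is, `(ξ, u, s) ↦ α_s(f(ξ, u))` is smooth), and
it is homogeneous of degree `d` where the parameter `u` counts with degree two. -/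
structure IsHomSymbol (θ : ℝ) (d : ℤ) (f : Sym) : Prop where
  mem : ∀ ξ u, 0 < u → f ξ u ∈ smooth θ
  contDiff : ContDiffOn ℝ ∞
    (fun p : (ℝ × ℝ) × ℝ × (ℝ × ℝ) => act p.2.2 (f p.1 p.2.1)) {p | 0 < p.2.1}
  homog : ∀ t : ℝ, 0 < t → ∀ ξ u, 0 < u → f (t • ξ) (t ^ 2 * u) = t ^ d • f ξ u

/-- The product of formal symbols, that is, the symbol of the composition of the corresponding
pseudodifferential operators `P_ρ(Uⁿ Vᵐ) = ρ(n, m) Uⁿ Vᵐ`: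
`∑_{l₁, l₂} 1 / (l₁! l₂!) ∂₁^{l₁} ∂₂^{l₂}(b) δ₁^{l₁} δ₂^{l₂}(a)`.
A formal symbol is the sequence of its homogeneous components, in decreasing order (the
`n`-th one being of order `m - n`, where `m` is the order of the symbol); the sum
below runs over `p = (i, j, l₁, l₂)` with `i + j + l₁ + l₂ = n`. -/
def comp (b a : ℕ → Sym) (n : ℕ) : Sym := fun ξ u =>
  ∑ p ∈ Finset.Nat.antidiagonalTuple 4 n,
    (((p 2).factorial * (p 3).factorial : ℝ)⁻¹) •
      (((pd 0)^[p 2] ((pd 1)^[p 3] (fun η => b (p 0) η u))) ξ *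
        (δ 0)^[p 2] ((δ 1)^[p 3] (a (p 1) ξ u)))

/-- The formal symbol of the identity. -/
def oneSym : ℕ → Sym
  | 0 => fun _ _ => 1
  | _ + 1 => fun _ _ => 0

/-- The coordinates of `ξ`. -/
def coord (j : Fin 2) (ξ : ℝ × ℝ) : ℝ := ![ξ.1, ξ.2] j

/-- The operator `k △ k`, where `△ = δ₁² + δ₂²` and `k` acts by left multiplication. -/
def lap (k f : Op) : Op := k * ∑ j : Fin 2, δ j (δ j (k * f))

/-- The Leibniz rule for `δ_j`. -/
theorem δ_mul {a b : Op} (ha : ContDiff ℝ ∞ (fun s => act s a))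
    (hb : ContDiff ℝ ∞ (fun s => act s b)) (j : Fin 2) :
    δ j (a * b) = δ j a * b + a * δ j b := by
  have da := ((ha.differentiable (by simp)).differentiableAt (x := 0)).lineDifferentiableAt
    (v := stdVec j) |>.hasLineDerivAt
  have db := ((hb.differentiable (by simp)).differentiableAt (x := 0)).lineDifferentiableAt
    (v := stdVec j) |>.hasLineDerivAt
  have hab : HasLineDerivAt ℝ (fun s => act s (a * b))
      (lineDeriv ℝ (fun s => act s a) 0 (stdVec j) * b
        + a * lineDeriv ℝ (fun s => act s b) 0 (stdVec j)) 0 (stdVec j) := by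
    have h := HasDerivAt.mul da db
    simp only [zero_smul, add_zero, act_zero] at h
    have e : (fun t : ℝ => act (0 + t • stdVec j) (a * b)) =
        (fun t : ℝ => act (0 + t • stdVec j) a) * fun t : ℝ => act (0 + t • stdVec j) b :=
      funext fun t => act_mul _ _ _
    unfold HasLineDerivAt
    rw [e]
    exact h
  rw [δ, hab.lineDeriv, δ, δ, smul_add, smul_mul_assoc, mul_smul_comm]

theorem act_δ {a : Op} (ha : ContDiff ℝ ∞ (fun s => act s a)) (j : Fin 2) (s : ℝ × ℝ) :
    act s (δ j a) = (-Complex.I) • fderiv ℝ (fun s => act s a) s (stdVec j) := by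
  have da := ((ha.differentiable (by simp)).differentiableAt (x := 0)).lineDifferentiableAt
    (v := stdVec j) |>.hasLineDerivAt
  have h : HasLineDerivAt ℝ (fun s => act s a)
      (act s (lineDeriv ℝ (fun s => act s a) 0 (stdVec j))) s (stdVec j) := by
    have h1 := (HasDerivAt.const_mul (W s) da).mul_const (W (-s))
    have e : (fun t : ℝ => act (s + t • stdVec j) a) =
        fun t : ℝ => W s * act (0 + t • stdVec j) a * W (-s) :=
      funext fun t => by rw [act_add, zero_add, act]
    unfold HasLineDerivAt
    rw [e]
    exact h1
  rw [← DifferentiableAt.lineDeriv_eq_fderiv ((ha.differentiable (by simp)) s), h.lineDeriv]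
  simp only [δ, act, mul_smul_comm, smul_mul_assoc]

theorem contDiff_act_δ {a : Op} (ha : ContDiff ℝ ∞ (fun s => act s a)) (j : Fin 2) :
    ContDiff ℝ ∞ (fun s => act s (δ j a)) := by
  simp only [act_δ ha]
  have h : ContDiff ℝ ∞ (fun s => fderiv ℝ (fun s => act s a) s (stdVec j)) :=
    (ha.fderiv_right (m := ∞) (by simp)).clm_apply contDiff_const
  exact h.const_smul (-Complex.I)

theorem δ_add {a b : Op} (ha : ContDiff ℝ ∞ (fun s => act s a))
    (hb : ContDiff ℝ ∞ (fun s => act s b)) (j : Fin 2) : δ j (a + b) = δ j a + δ j b := by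
  have da := (ha.differentiable (by simp)) 0
  have db := (hb.differentiable (by simp)) 0
  have h : (fun s => act s (a + b)) = (fun s => act s a) + (fun s => act s b) := by
    funext s
    simp [act, mul_add, add_mul]
  rw [δ, h, (da.add db).lineDeriv_eq_fderiv, fderiv_add da db, δ, δ, da.lineDeriv_eq_fderiv,
    db.lineDeriv_eq_fderiv, ← smul_add]
  rfl

/-- The polynomial `∑ a_α ξ^α = lapSym k 0 + lapSym k 1 + lapSym k 2` defined below is the
symbol of `k △ k + u`, since `k △ k + u = ∑ a_α δ^α` as operators. -/
theorem lap_add_smul_eq {k f : Op} (hk : ContDiff ℝ ∞ (fun s => act s k))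
    (hf : ContDiff ℝ ∞ (fun s => act s f)) (u : ℝ) :
    lap k f + u • f =
      (k ^ 2 * ∑ j : Fin 2, δ j (δ j f) + u • f) + (∑ j : Fin 2, (2 : ℝ) • (k * δ j k * δ j f))
        + (∑ j : Fin 2, k * δ j (δ j k)) * f := by
  have key : ∀ j, δ j (δ j (k * f)) = δ j (δ j k) * f + (2 : ℝ) • (δ j k * δ j f)
      + k * δ j (δ j f) := by
    intro j
    have h1 := contDiff_act_δ hk j
    have h2 := contDiff_act_δ hf j
    have m1 : ContDiff ℝ ∞ (fun s => act s (δ j k * f)) := by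
      simp only [act_mul]
      exact h1.mul hf
    have m2 : ContDiff ℝ ∞ (fun s => act s (k * δ j f)) := by
      simp only [act_mul]
      exact hk.mul h2
    rw [δ_mul hk hf, δ_add m1 m2, δ_mul h1 hf, δ_mul hk h2, two_smul]
    abel
  simp only [lap, key, Fin.sum_univ_two, mul_add, add_mul, mul_smul_comm, pow_two, mul_assoc]
  abel

/-- The formal symbol `a₂ + a₁ + a₀` of `k △ k + u`:
`a₂ = k²|ξ|² + u`, `a₁ = ∑ 2 ξ_j k δ_j(k)`, `a₀ = ∑ k δ_j²(k)`. -/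
def lapSym (k : Op) : ℕ → Sym
  | 0 => fun ξ u => (∑ j : Fin 2, coord j ξ ^ 2) • k ^ 2 + u • (1 : Op)
  | 1 => fun ξ _ => ∑ j : Fin 2, (2 * coord j ξ) • (k * δ j k)
  | 2 => fun _ _ => ∑ j : Fin 2, k * δ j (δ j k)
  | _ + 3 => fun _ _ => 0

/-- `∑_j b_j` is the symbol of a parametrix of `k △ k + u`, an approximation of the inverse in the
space of symbols: `b_j` is homogeneous of order `-2 - j` and
`(∑_j b_j) ∘ (a₂ + a₁ + a₀) = 1` as formal symbols. -/
structure IsParametrix (θ : ℝ) (k : Op) (b : ℕ → Sym) : Prop where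
  symbol : ∀ j : ℕ, IsHomSymbol θ (-2 - j) (b j)
  inverse : ∀ (n : ℕ) (ξ : ℝ × ℝ) (u : ℝ), 0 < u → comp b (lapSym k) n ξ u = oneSym n ξ u

/-! ### The explicit expression -/

/-- `b₀ = (k² r² + 1)⁻¹`. -/
def b₀ (k : Op) (r : ℝ) : Op := Ring.inverse (r ^ 2 • k ^ 2 + 1)

/-- The explicit expression `T(r)` (the sum over the repeated index `i` is written out). -/
def T (k : Op) (r : ℝ) : Op :=
  let b := b₀ k r
  ∑ i : Fin 2,
    let d := δ i k
    let dd := δ i (δ i k)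
    (- (b * k * dd) + (3 * r ^ 2) • (k ^ 3 * b ^ 2 * dd) + (4 * r ^ 2) • (k ^ 2 * b ^ 2 * d * d)
      + r ^ 2 • (k ^ 2 * b ^ 2 * dd * k)
      - (2 * r ^ 4) • (k ^ 5 * b ^ 3 * dd) - (4 * r ^ 4) • (k ^ 4 * b ^ 3 * d * d)
      - (2 * r ^ 4) • (k ^ 4 * b ^ 3 * dd * k)
      + r ^ 2 • (k * b * d * b * ((4 : ℝ) • (k * d) + (2 : ℝ) • (d * k)))
      - (2 * r ^ 4) • (k * b * d * k ^ 2 * b ^ 2 * (k * d + d * k))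
      - r ^ 4 • (k ^ 3 * b ^ 2 * d * b * ((8 : ℝ) • (k * d) + (6 : ℝ) • (d * k)))
      + (2 * r ^ 6) • (k ^ 3 * b ^ 2 * d * k ^ 2 * b ^ 2 * (k * d + d * k))
      - r ^ 4 • (k ^ 2 * b ^ 2 * d * k * b * ((6 : ℝ) • (k * d) + (4 : ℝ) • (d * k)))
      + (2 * r ^ 6) • (k ^ 2 * b ^ 2 * d * k ^ 3 * b ^ 2 * (k * d + d * k))
      + (4 * r ^ 6) • (k ^ 5 * b ^ 3 * d * b * (k * d + d * k))
      + (4 * r ^ 6) • (k ^ 4 * b ^ 3 * d * k * b * (k * d + d * k)))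

end NCTorus

end

/-! Write `K = k²`, `q = |ξ|²`. The composition formula in degrees 0, 1, 2 determines `b₀`, `b₁`,
`b₂` recursively, each degree being solved by multiplying on the right by `b₀ = (qK + 1)⁻¹`. Since
`b₀` is radial, `b₁` is linear in `ξ` with radial coefficients, and `b₂ = -(P + ξ₁² Q₀ + ξ₂² Q₁ +
ξ₁ξ₂ N) b₀` with `P`, `Q₀`, `Q₁`, `N` functions of `q` alone (`parametrix_one`, `parametrix_two`).
In polar coordinates the angular integral kills `ξ₁ξ₂` and replaces `ξ₁²` and `ξ₂²` by their mean
`r²/2` (`integral_polar_of_quadratic`). What remains is `-(P + (r²/2)(Q₀ + Q₁)) b₀`, and its left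
factor is `T(r)` for each single `r` (`T_eq`): this uses only the Leibniz rule and the commutation
of `k` with `b₀`, neither a trace nor an integration by parts.

For convergence, `k` is self-adjoint and invertible, so `b₀ = O((1 + q)⁻¹)` (`decay_res_sq`).
Counting powers gives `P b₀ = O((1 + q)⁻²)` and `O((1 + q)⁻³)` for the coefficients of the quadratic
monomials, so `b₂ = O((1 + |ξ|²)⁻²)`, which is integrable on the plane (`integrable_of_decay`). -/

namespace NCTorus

/-! ### Polar coordinates and angular averages. -/

section Polar

variable {E : Type*} [NormedAddCommGroup E] [NormedSpace ℝ E]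

/-- Change of variables with Jacobian `r`; this is the integrability on the product that Fubini
needs below. -/
theorem integrableOn_polarCoord_target {f : ℝ × ℝ → E} (hf : Integrable f) :
    IntegrableOn (fun p => p.1 • f (polarCoord.symm p)) polarCoord.target := by
  have hs : MeasurableSet polarCoord.target := polarCoord.open_target.measurableSet
  have h := (integrableOn_image_iff_integrableOn_abs_det_fderiv_smul volume hs
    (fun p _ => (hasFDerivAt_polarCoord_symm p).hasFDerivWithinAt)
    polarCoord.symm.injOn f).1 hf.integrableOn
  refine h.congr_fun (fun p hp => ?_) hs
  have hp0 : 0 < p.1 := by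
    rw [polarCoord_target] at hp
    exact hp.1
  simp only [det_fderivPolarCoordSymm, abs_of_pos hp0]

theorem integral_quadratic_trig [CompleteSpace E] (a b c d : E) :
    ∫ φ in Ioo (-Real.pi) Real.pi, (a + (Real.cos φ ^ 2) • b + (Real.sin φ ^ 2) • c
      + (Real.sin φ * Real.cos φ) • d) = Real.pi • ((2 : ℝ) • a + b + c) := by
  have hpi : -Real.pi ≤ Real.pi := by linarith [Real.pi_pos]
  rw [← integral_Ioc_eq_integral_Ioo, ← intervalIntegral.integral_of_le hpi]
  have i1 : ∀ (g : ℝ → E), Continuous g → IntervalIntegrable g volume (-Real.pi) Real.pi :=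
    fun g hg => hg.intervalIntegrable _ _
  rw [intervalIntegral.integral_add (i1 _ (by fun_prop)) (i1 _ (by fun_prop)),
    intervalIntegral.integral_add (i1 _ (by fun_prop)) (i1 _ (by fun_prop)),
    intervalIntegral.integral_add (i1 _ (by fun_prop)) (i1 _ (by fun_prop)),
    intervalIntegral.integral_smul_const, intervalIntegral.integral_smul_const,
    intervalIntegral.integral_smul_const, intervalIntegral.integral_const,
    integral_cos_sq, integral_sin_sq, integral_sin_mul_cos₁]
  simp only [Real.sin_neg, Real.sin_pi, Real.cos_neg, Real.cos_pi]
  module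

/-- The integral over the plane of a function that is quadratic in the angular variables. -/
theorem integral_polar_of_quadratic [CompleteSpace E] {f : ℝ × ℝ → E} (hf : Integrable f)
    (a b c d : ℝ → E)
    (h : ∀ x y : ℝ, f (x, y) = a (x ^ 2 + y ^ 2) + (x ^ 2) • b (x ^ 2 + y ^ 2)
      + (y ^ 2) • c (x ^ 2 + y ^ 2) + (x * y) • d (x ^ 2 + y ^ 2)) :
    IntegrableOn (fun r : ℝ => r • (a (r ^ 2) + (r ^ 2 / 2) • (b (r ^ 2) + c (r ^ 2)))) (Ioi 0) ∧
    ∫ ξ, f ξ = (2 * Real.pi) •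
      ∫ r in Ioi (0 : ℝ), r • (a (r ^ 2) + (r ^ 2 / 2) • (b (r ^ 2) + c (r ^ 2))) := by
  have hi := integrableOn_polarCoord_target hf
  rw [polarCoord_target, IntegrableOn, Measure.volume_eq_prod, ← Measure.prod_restrict] at hi
  have key : ∀ r : ℝ, ∫ φ in Ioo (-Real.pi) Real.pi, r • f (polarCoord.symm (r, φ)) =
      (2 * Real.pi) • (r • (a (r ^ 2) + (r ^ 2 / 2) • (b (r ^ 2) + c (r ^ 2)))) := by
    intro r
    have e : ∀ φ : ℝ, f (polarCoord.symm (r, φ)) =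
        a (r ^ 2) + (Real.cos φ ^ 2) • (r ^ 2 • b (r ^ 2)) +
        (Real.sin φ ^ 2) • (r ^ 2 • c (r ^ 2)) +
        (Real.sin φ * Real.cos φ) • (r ^ 2 • d (r ^ 2)) := by
      intro φ
      have hr : (r * Real.cos φ) ^ 2 + (r * Real.sin φ) ^ 2 = r ^ 2 := by
        linear_combination r ^ 2 * Real.cos_sq_add_sin_sq φ
      rw [polarCoord_symm_apply, h, hr]
      module
    rw [integral_smul]
    simp only [e]
    rw [integral_quadratic_trig]
    module
  constructor
  -- By Fubini the angular integral is integrable in `r`; by `key` it is `2π` times the radial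
  -- integrand.
  · have h2 := hi.integral_prod_left
    simp only [key] at h2
    exact (integrable_smul_iff (by positivity) _).1 h2
  · rw [← integral_comp_polarCoord_symm, polarCoord_target, Measure.volume_eq_prod,
      ← Measure.prod_restrict, integral_prod _ hi]
    simp only [key]
    rw [integral_smul]

end Polar

/-! ### Decay in `q = |ξ|²` and integrability on the plane. -/

section Decay

variable {A : Type*} [NormedRing A]

/-- `f(q) = O((1 + q)^(-n))` uniformly on `q ≥ 0`. -/
def Decay (n : ℕ) (f : ℝ → A) : Prop := ∃ C, ∀ q, 0 ≤ q → (1 + q) ^ n * ‖f q‖ ≤ C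

theorem Decay.const (a : A) : Decay 0 (fun _ => a) := ⟨‖a‖, fun q _ => by simp⟩

theorem Decay.add {n : ℕ} {f g : ℝ → A} (hf : Decay n f) (hg : Decay n g) :
    Decay n (fun q => f q + g q) := by
  obtain ⟨C, hC⟩ := hf
  obtain ⟨D, hD⟩ := hg
  refine ⟨C + D, fun q hq => ?_⟩
  calc (1 + q) ^ n * ‖f q + g q‖ ≤ (1 + q) ^ n * (‖f q‖ + ‖g q‖) := by
        gcongr; exact norm_add_le _ _
    _ ≤ C + D := by rw [mul_add]; exact add_le_add (hC q hq) (hD q hq)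

theorem Decay.neg {n : ℕ} {f : ℝ → A} (hf : Decay n f) : Decay n (fun q => -f q) := by
  simpa only [Decay, norm_neg] using hf

theorem Decay.sub {n : ℕ} {f g : ℝ → A} (hf : Decay n f) (hg : Decay n g) :
    Decay n (fun q => f q - g q) := by
  simpa only [sub_eq_add_neg] using hf.add hg.neg

theorem Decay.mul {n m : ℕ} {f g : ℝ → A} (hf : Decay n f) (hg : Decay m g) :
    Decay (n + m) (fun q => f q * g q) := by
  obtain ⟨C, hC⟩ := hf
  obtain ⟨D, hD⟩ := hg
  refine ⟨C * D, fun q hq => ?_⟩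
  calc (1 + q) ^ (n + m) * ‖f q * g q‖ ≤ (1 + q) ^ (n + m) * (‖f q‖ * ‖g q‖) := by
        gcongr; exact norm_mul_le _ _
    _ = ((1 + q) ^ n * ‖f q‖) * ((1 + q) ^ m * ‖g q‖) := by ring
    _ ≤ C * D := mul_le_mul (hC q hq) (hD q hq) (by positivity)
        ((by positivity : (0 : ℝ) ≤ (1 + q) ^ n * ‖f q‖).trans (hC q hq))

theorem Decay.const_mul {n : ℕ} {f : ℝ → A} (a : A) (hf : Decay n f) :
    Decay n (fun q => a * f q) := by
  simpa only [zero_add] using (Decay.const a).mul hf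

theorem Decay.mul_const {n : ℕ} {f : ℝ → A} (hf : Decay n f) (a : A) :
    Decay n (fun q => f q * a) := hf.mul (Decay.const a)

theorem Decay.pow {f : ℝ → A} (hf : Decay 1 f) (n : ℕ) : Decay n (fun q => f q ^ n) := by
  induction n with
  | zero => simpa only [pow_zero] using Decay.const (1 : A)
  | succ n ih => simpa only [pow_succ] using ih.mul hf

variable [NormedAlgebra ℝ A]

theorem Decay.const_smul {n : ℕ} {f : ℝ → A} (c : ℝ) (hf : Decay n f) :
    Decay n (fun q => c • f q) := by
  obtain ⟨C, hC⟩ := hf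
  refine ⟨‖c‖ * C, fun q hq => ?_⟩
  calc (1 + q) ^ n * ‖c • f q‖ = ‖c‖ * ((1 + q) ^ n * ‖f q‖) := by rw [norm_smul]; ring
    _ ≤ ‖c‖ * C := by gcongr; exact hC q hq

/-- A factor `q ≤ 1 + q` costs one order of decay. -/
theorem Decay.mul_smul {n : ℕ} {f : ℝ → A} (c : ℝ) (hf : Decay (n + 1) f) :
    Decay n (fun q => (c * q) • f q) := by
  obtain ⟨C, hC⟩ := hf
  refine ⟨‖c‖ * C, fun q hq => ?_⟩
  calc (1 + q) ^ n * ‖(c * q) • f q‖ = ‖c‖ * ((1 + q) ^ n * q * ‖f q‖) := by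
        rw [norm_smul, norm_mul, Real.norm_of_nonneg hq]; ring
    _ ≤ ‖c‖ * ((1 + q) ^ n * (1 + q) * ‖f q‖) := by gcongr; linarith
    _ ≤ ‖c‖ * C := by gcongr; rw [← pow_succ]; exact hC q hq

theorem Decay.smul {n : ℕ} {f : ℝ → A} (hf : Decay (n + 1) f) : Decay n (fun q => q • f q) := by
  simpa only [one_mul] using hf.mul_smul 1

/-- A continuous function on the plane, quadratic with coefficients decaying in `|ξ|²`,
is integrable. -/
theorem integrable_of_decay {f : ℝ × ℝ → A} (hc : Continuous f) (a b c d : ℝ → A)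
    (h : ∀ x y : ℝ, f (x, y) = a (x ^ 2 + y ^ 2) + (x ^ 2) • b (x ^ 2 + y ^ 2)
      + (y ^ 2) • c (x ^ 2 + y ^ 2) + (x * y) • d (x ^ 2 + y ^ 2))
    (ha : Decay 2 a) (hb : Decay 3 b) (hc' : Decay 3 c) (hd : Decay 3 d) : Integrable f := by
  obtain ⟨Ca, ha⟩ := ha
  obtain ⟨Cb, hb⟩ := hb
  obtain ⟨Cc, hc'⟩ := hc'
  obtain ⟨Cd, hd⟩ := hd
  -- The majorant is `(1 + ‖ξ‖²)⁻²`: the exponent 4 exceeds the dimension 2. The norm on `ℝ × ℝ` is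
  -- the maximum norm, so `‖ξ‖² ≤ q` and decay in `q` suffices.
  have hg : Integrable (fun ξ : ℝ × ℝ =>
      (Ca + Cb + Cc + Cd) * (1 + ‖ξ‖ ^ 2) ^ (-(4 : ℝ) / 2)) :=
    (integrable_rpow_neg_one_add_norm_sq (by simp; norm_num)).const_mul _
  refine hg.mono' hc.aestronglyMeasurable (Filter.Eventually.of_forall fun ξ => ?_)
  obtain ⟨x, y⟩ := ξ
  set q := x ^ 2 + y ^ 2 with hq
  have hq0 : 0 ≤ q := by positivity
  have hn : ‖(x, y)‖ ^ 2 ≤ q := by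
    rw [Prod.norm_def, Real.norm_eq_abs, Real.norm_eq_abs]
    rcases max_choice |x| |y| with e | e <;> rw [e, sq_abs] <;> nlinarith [sq_nonneg x, sq_nonneg y]
  have hw : (1 + ‖(x, y)‖ ^ 2) ^ (-(4 : ℝ) / 2) = ((1 + ‖(x, y)‖ ^ 2) ^ 2)⁻¹ := by
    rw [show (-(4 : ℝ) / 2) = -((2 : ℕ) : ℝ) by norm_num, Real.rpow_neg (by positivity),
      Real.rpow_natCast]
  have hm : (1 + q) ^ 2 * ‖f (x, y)‖ ≤ Ca + Cb + Cc + Cd := by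
    rw [h, ← hq]
    have n1 : ‖a q + (x ^ 2) • b q + (y ^ 2) • c q + (x * y) • d q‖ ≤
        ‖a q‖ + (1 + q) * ‖b q‖ + (1 + q) * ‖c q‖ + (1 + q) * ‖d q‖ := by
      refine (norm_add_le _ _).trans (add_le_add ((norm_add_le _ _).trans
        (add_le_add ((norm_add_le _ _).trans (add_le_add le_rfl ?_)) ?_)) ?_)
      · rw [norm_smul, Real.norm_of_nonneg (sq_nonneg _)]
        gcongr
        nlinarith [sq_nonneg y]
      · rw [norm_smul, Real.norm_of_nonneg (sq_nonneg _)]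
        gcongr
        nlinarith [sq_nonneg x]
      · rw [norm_smul, Real.norm_eq_abs]
        gcongr
        rw [abs_le]
        constructor <;> nlinarith [sq_nonneg (x + y), sq_nonneg (x - y)]
    have n2 := ha q hq0
    have n3 := hb q hq0
    have n4 := hc' q hq0
    have n5 := hd q hq0
    calc _ ≤ (1 + q) ^ 2 * (‖a q‖ + (1 + q) * ‖b q‖ + (1 + q) * ‖c q‖ + (1 + q) * ‖d q‖) := by
          gcongr
      _ = (1 + q) ^ 2 * ‖a q‖ + (1 + q) ^ 3 * ‖b q‖ + (1 + q) ^ 3 * ‖c q‖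
          + (1 + q) ^ 3 * ‖d q‖ := by ring
      _ ≤ _ := by linarith
  rw [hw, ← div_eq_mul_inv, le_div_iff₀ (by positivity), mul_comm]
  refine le_trans ?_ hm
  gcongr

end Decay

/-! ### The resolvent `(qK + 1)⁻¹` and its derivatives in `q`. -/

section Calculus

variable {A : Type*} [NormedRing A] [NormedAlgebra ℝ A]

/-- The function `q ↦ (q K + 1)⁻¹`. -/
noncomputable def res (K : A) (q : ℝ) : A := Ring.inverse (q • K + 1)

theorem commute_res {a K : A} (h : Commute a K) (q : ℝ) : Commute a (res K q) := by
  by_cases hu : IsUnit (q • K + 1)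
  · obtain ⟨v, hv⟩ := hu
    rw [res, ← hv, Ring.inverse_unit]
    refine Commute.units_inv_right ?_
    rw [hv]
    exact (h.smul_right q).add_right (Commute.one_right a)
  · rw [res, Ring.inverse_non_unit _ hu]
    exact Commute.zero_right a

/-- The coefficient `B_j` of `ξ_j` in `b₁`, for `m = k δ_j(k)` and `κ = δ_j(k²)`. -/
noncomputable def coeffB (K m κ : A) (q : ℝ) : A :=
  (2 * q) • (K * res K q ^ 2 * κ * res K q) - (2 : ℝ) • (res K q * m * res K q)

/-- The derivative of `coeffB` with respect to `q = |ξ|²`. -/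
noncomputable def coeffB' (K m κ : A) (q : ℝ) : A :=
  (2 : ℝ) • (K * res K q ^ 2 * κ * res K q)
    - (4 * q) • (K ^ 2 * res K q ^ 3 * κ * res K q)
    - (2 * q) • (K * res K q ^ 2 * κ * (K * res K q ^ 2))
    + (2 : ℝ) • (K * res K q ^ 2 * m * res K q)
    + (2 : ℝ) • (res K q * m * (K * res K q ^ 2))

variable [CompleteSpace A]

/-- The derivative of inversion gives `-res K res`; the two resolvents are then collected because
they commute with `K`. -/
theorem hasDerivAt_res {K : A} {q : ℝ} (h : IsUnit (q • K + 1)) :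
    HasDerivAt (res K) (-(K * res K q ^ 2)) q := by
  obtain ⟨v, hv⟩ := h
  have h1 : HasDerivAt (fun q : ℝ => q • K + 1) K q := by
    simpa using ((hasDerivAt_id q).smul_const K).add_const (1 : A)
  have h2 := hasFDerivAt_ringInverse (𝕜 := ℝ) v
  rw [hv] at h2
  have h3 := h2.comp_hasDerivAt q h1
  have e : ((v⁻¹ : Aˣ) : A) = res K q := by rw [res, ← hv, Ring.inverse_unit]
  refine h3.congr_deriv ?_
  rw [neg_apply, ContinuousLinearMap.mulLeftRight_apply, e]
  rw [pow_two, ← mul_assoc, (commute_res (Commute.refl K) q).eq]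

theorem hasDerivAt_mul_res_sq {K : A} {q : ℝ} (h : IsUnit (q • K + 1)) :
    HasDerivAt (fun q => K * res K q ^ 2) (-((2 : ℝ) • (K ^ 2 * res K q ^ 3))) q := by
  have h1 := hasDerivAt_res h
  have h2 := (h1.mul h1).const_mul K
  simp only [pow_two]
  refine h2.congr_deriv ?_
  have hc := (commute_res (Commute.refl K) q).eq
  have hc' : ∀ x, res K q * (K * x) = K * (res K q * x) := fun x => by
    rw [← mul_assoc, ← hc, mul_assoc]
  simp only [pow_succ, pow_zero, one_mul, mul_assoc, neg_mul, mul_neg, mul_add, hc']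
  module

theorem hasDerivAt_coeffB {K : A} (m κ : A) {q : ℝ} (h : IsUnit (q • K + 1)) :
    HasDerivAt (coeffB K m κ) (coeffB' K m κ q) q := by
  have h1 := hasDerivAt_res h
  have h2 := hasDerivAt_mul_res_sq h
  have h3 := (((hasDerivAt_id q).const_mul (2 : ℝ)).smul ((h2.mul_const κ).mul h1)).sub
    (((h1.mul_const m).mul h1).const_smul (2 : ℝ))
  refine h3.congr_deriv ?_
  simp only [coeffB', id, Pi.mul_apply, mul_one, mul_neg, neg_mul, smul_mul_assoc, mul_assoc]
  module

end Calculus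

section Decay

variable {A : Type*} [NormedRing A] [NormedAlgebra ℝ A]

theorem decay_coeffB {K : A} (h : Decay 1 (res K)) (m κ : A) : Decay 2 (coeffB K m κ) :=
  (Decay.mul_smul 2 ((((h.pow 2).const_mul K).mul_const κ).mul h)).sub
    (((h.mul_const m).mul h).const_smul 2)

theorem decay_coeffB' {K : A} (h : Decay 1 (res K)) (m κ : A) : Decay 3 (coeffB' K m κ) :=
  have h2 := (h.pow 2).const_mul K
  (((((((h2.mul_const κ).mul h).const_smul 2).sub
    (Decay.mul_smul 4 ((((h.pow 3).const_mul (K ^ 2)).mul_const κ).mul h))).sub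
    (Decay.mul_smul 2 ((h2.mul_const κ).mul h2))).add
    (((h2.mul_const m).mul h).const_smul 2)).add
    (((h.mul_const m).mul h2).const_smul 2))

end Decay

/-! ### Radial coefficients of `b₂` and their decay. -/

section Coefficients

variable {A : Type*} [NormedRing A] [NormedAlgebra ℝ A]

/-- The radial part of `-b₂ b₀⁻¹`, see `parametrix_two`. -/
noncomputable def coeffP (K a : A) (m κ : Fin 2 → A) (M : A) (q : ℝ) : A :=
  res K q * a + q • (coeffB K (m 0) (κ 0) q * κ 0) + q • (coeffB K (m 1) (κ 1) q * κ 1)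
    - q • (K * res K q ^ 2 * M)

/-- The coefficient of `ξ_i²` in `-b₂ b₀⁻¹`. -/
noncomputable def coeffQ (K m κ e M : A) (q : ℝ) : A :=
  (2 : ℝ) • (coeffB K m κ q * m) + (2 * q) • (coeffB' K m κ q * κ)
    - (4 : ℝ) • (K * res K q ^ 2 * e) + (4 * q) • (K ^ 2 * res K q ^ 3 * M)

/-- The coefficient of `ξ₁ ξ₂` in `-b₂ b₀⁻¹`. -/
noncomputable def coeffN (K : A) (m κ : Fin 2 → A) (e M : A) (q : ℝ) : A :=
  (2 : ℝ) • (coeffB K (m 0) (κ 0) q * m 1) + (2 : ℝ) • (coeffB K (m 1) (κ 1) q * m 0)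
    + (2 * q) • (coeffB' K (m 0) (κ 0) q * κ 1) + (2 * q) • (coeffB' K (m 1) (κ 1) q * κ 0)
    - (4 : ℝ) • (K * res K q ^ 2 * e) + (8 * q) • (K ^ 2 * res K q ^ 3 * M)

theorem decay_coeffP {K : A} (h : Decay 1 (res K)) (a : A) (m κ : Fin 2 → A) (M : A) :
    Decay 1 (coeffP K a m κ M) :=
  (((h.mul_const a).add (Decay.smul ((decay_coeffB h _ _).mul_const _))).add
    (Decay.smul ((decay_coeffB h _ _).mul_const _))).sub
    (Decay.smul (((h.pow 2).const_mul K).mul_const M))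

theorem decay_coeffQ {K : A} (h : Decay 1 (res K)) (m κ e M : A) :
    Decay 2 (coeffQ K m κ e M) :=
  (((((decay_coeffB h _ _).mul_const _).const_smul 2).add
    (Decay.mul_smul 2 ((decay_coeffB' h _ _).mul_const _))).sub
    ((((h.pow 2).const_mul K).mul_const e).const_smul 4)).add
    (Decay.mul_smul 4 (((h.pow 3).const_mul (K ^ 2)).mul_const M))

theorem decay_coeffN {K : A} (h : Decay 1 (res K)) (m κ : Fin 2 → A) (e M : A) :
    Decay 2 (coeffN K m κ e M) :=
  (((((((decay_coeffB h _ _).mul_const _).const_smul 2).add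
    (((decay_coeffB h _ _).mul_const _).const_smul 2)).add
    (Decay.mul_smul 2 ((decay_coeffB' h _ _).mul_const _))).add
    (Decay.mul_smul 2 ((decay_coeffB' h _ _).mul_const _))).sub
    ((((h.pow 2).const_mul K).mul_const e).const_smul 4)).add
    (Decay.mul_smul 8 (((h.pow 3).const_mul (K ^ 2)).mul_const M))

end Coefficients

/-! ### The algebraic identity behind `T(r)`. -/

section Identity

variable {A : Type*} [NormedRing A] [NormedAlgebra ℝ A]

/-- The summand of `T(r)`, for `b = b₀`, `d = δ_i(k)` and `D = δ_i²(k)`. -/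
def summandT (k b d D : A) (r : ℝ) : A :=
  (- (b * k * D) + (3 * r ^ 2) • (k ^ 3 * b ^ 2 * D) + (4 * r ^ 2) • (k ^ 2 * b ^ 2 * d * d)
      + r ^ 2 • (k ^ 2 * b ^ 2 * D * k)
      - (2 * r ^ 4) • (k ^ 5 * b ^ 3 * D) - (4 * r ^ 4) • (k ^ 4 * b ^ 3 * d * d)
      - (2 * r ^ 4) • (k ^ 4 * b ^ 3 * D * k)
      + r ^ 2 • (k * b * d * b * ((4 : ℝ) • (k * d) + (2 : ℝ) • (d * k)))
      - (2 * r ^ 4) • (k * b * d * k ^ 2 * b ^ 2 * (k * d + d * k))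
      - r ^ 4 • (k ^ 3 * b ^ 2 * d * b * ((8 : ℝ) • (k * d) + (6 : ℝ) • (d * k)))
      + (2 * r ^ 6) • (k ^ 3 * b ^ 2 * d * k ^ 2 * b ^ 2 * (k * d + d * k))
      - r ^ 4 • (k ^ 2 * b ^ 2 * d * k * b * ((6 : ℝ) • (k * d) + (4 : ℝ) • (d * k)))
      + (2 * r ^ 6) • (k ^ 2 * b ^ 2 * d * k ^ 3 * b ^ 2 * (k * d + d * k))
      + (4 * r ^ 6) • (k ^ 5 * b ^ 3 * d * b * (k * d + d * k))
      + (4 * r ^ 6) • (k ^ 4 * b ^ 3 * d * k * b * (k * d + d * k)))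

/-- A formal identity between noncommutative polynomials in `k`, `b`, `d`, `D` subject only to `bk =
kb`; the relation `(r²k² + 1) b = 1` plays no role. -/
theorem summandT_eq (k d D : A) (r : ℝ) :
    summandT k (res (k ^ 2) (r ^ 2)) d D r =
      -(res (k ^ 2) (r ^ 2) * (k * D)
        + r ^ 2 • (coeffB (k ^ 2) (k * d) (d * k + k * d) (r ^ 2) * (d * k + k * d))
        - r ^ 2 • (k ^ 2 * res (k ^ 2) (r ^ 2) ^ 2 * (D * k + d * d + (d * d + k * D)))
        + (r ^ 2 / 2) • coeffQ (k ^ 2) (k * d) (d * k + k * d) (d * d + k * D)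
            (D * k + d * d + (d * d + k * D)) (r ^ 2)) := by
  have hc : Commute k (res (k ^ 2) (r ^ 2)) :=
    commute_res (Commute.pow_right (Commute.refl k) 2) _
  simp only [summandT, coeffQ, coeffB, coeffB']
  generalize res (k ^ 2) (r ^ 2) = b at hc ⊢
  -- Moving every `k` to the left past `b` gives a normal form for words, after which only scalar
  -- coefficients have to be compared.
  have e : b * k = k * b := hc.eq.symm
  have e' : ∀ x, b * (k * x) = k * (b * x) := fun x => by rw [← mul_assoc, e, mul_assoc]
  simp only [pow_succ k, pow_succ (k * k), pow_succ b, pow_zero, one_mul, mul_assoc, mul_add, add_mul, sub_mul,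
    smul_mul_assoc, mul_smul_comm, smul_add, smul_sub, e, e']
  module

end Identity

/-! ### Smooth elements under the action and the derivations. -/

section Smooth

theorem contDiff_act_mul {a b : Op} (ha : ContDiff ℝ ∞ (fun s => act s a))
    (hb : ContDiff ℝ ∞ (fun s => act s b)) : ContDiff ℝ ∞ (fun s => act s (a * b)) := by
  simp only [act_mul]
  exact ha.mul hb

theorem act_smul (s : ℝ × ℝ) (c : ℝ) (a : Op) : act s (c • a) = c • act s a := by
  simp only [act, mul_smul_comm, smul_mul_assoc]

theorem contDiff_act_smul {a : Op} (ha : ContDiff ℝ ∞ (fun s => act s a)) (c : ℝ) :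
    ContDiff ℝ ∞ (fun s => act s (c • a)) := by
  simp only [act_smul]
  exact ha.const_smul c

theorem act_one (s : ℝ × ℝ) : act s 1 = 1 := by
  rw [act, mul_one, ← W_add, add_neg_cancel, W_zero]

theorem δ_one (j : Fin 2) : δ j 1 = 0 := by
  simp only [δ, act_one]
  have h : HasLineDerivAt ℝ (fun _ : ℝ × ℝ => (1 : Op)) 0 0 (stdVec j) := hasDerivAt_const _ _
  rw [h.lineDeriv, smul_zero]

theorem δ_smul {a : Op} (ha : ContDiff ℝ ∞ (fun s => act s a)) (c : ℝ) (j : Fin 2) :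
    δ j (c • a) = c • δ j a := by
  have da := (ha.differentiable (by simp)) 0
  simp only [δ, act_smul]
  have h : HasLineDerivAt ℝ (fun s => c • act s a)
      (c • lineDeriv ℝ (fun s => act s a) 0 (stdVec j)) 0 (stdVec j) :=
    HasDerivAt.const_smul c da.lineDifferentiableAt.hasLineDerivAt
  rw [h.lineDeriv]
  exact smul_comm _ _ _

/-- The action is conjugation by the invertible `W s`, hence commutes with the exponential, which is
analytic. -/
theorem contDiff_act_exp {a : Op} (ha : ContDiff ℝ ∞ (fun s => act s a)) :
    ContDiff ℝ ∞ (fun s => act s (NormedSpace.exp a)) := by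
  have e : ∀ s, act s (NormedSpace.exp a) = NormedSpace.exp (act s a) := by
    intro s
    let _ : NormedAlgebra ℚ Op := NormedAlgebra.restrictScalars ℚ ℂ Op
    let w : Opˣ := ⟨W s, W (-s), by rw [← W_add, add_neg_cancel, W_zero], W_neg_mul s⟩
    exact (NormedSpace.exp_units_conj w a).symm
  simp only [e]
  have hexp : ContDiff ℝ ∞ (NormedSpace.exp : Op → Op) :=
    contDiff_iff_contDiffAt.2 fun x => (NormedSpace.exp_analytic (𝕂 := ℝ) x).contDiffAt
  exact hexp.comp ha

end Smooth

/-! ### Derivatives in `ξ` of radial functions and of coordinates times radial functions. -/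

section PartialDerivatives

/-- `|ξ|²`. -/
def normSq (ξ : ℝ × ℝ) : ℝ := ∑ j : Fin 2, coord j ξ ^ 2

theorem normSq_mk (x y : ℝ) : normSq (x, y) = x ^ 2 + y ^ 2 := by
  simp [normSq, coord]

theorem normSq_nonneg (ξ : ℝ × ℝ) : 0 ≤ normSq ξ := Finset.sum_nonneg fun _ _ => sq_nonneg _

theorem hasDerivAt_coord (i j : Fin 2) (ξ : ℝ × ℝ) :
    HasDerivAt (fun t : ℝ => coord i (ξ + t • stdVec j)) (if i = j then 1 else 0) 0 := by
  have h : ∀ t : ℝ, coord i (ξ + t • stdVec j) = coord i ξ + t * (if i = j then 1 else 0) := by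
    intro t
    fin_cases i <;> fin_cases j <;> simp [coord, stdVec]
  simp only [h]
  simpa using ((hasDerivAt_id (0 : ℝ)).mul_const (if i = j then (1 : ℝ) else 0)).const_add
    (coord i ξ)

theorem hasDerivAt_normSq (j : Fin 2) (ξ : ℝ × ℝ) :
    HasDerivAt (fun t : ℝ => normSq (ξ + t • stdVec j)) (2 * coord j ξ) 0 := by
  have h := HasDerivAt.fun_sum (u := Finset.univ)
    fun (i : Fin 2) _ => (hasDerivAt_coord i j ξ).fun_pow 2
  refine h.congr_deriv ?_
  fin_cases j <;> simp

theorem hasLineDerivAt_radial {F : ℝ → Op} {F' : Op} {ξ : ℝ × ℝ}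
    (hF : HasDerivAt F F' (normSq ξ)) (j : Fin 2) :
    HasLineDerivAt ℝ (fun η => F (normSq η)) ((2 * coord j ξ) • F') ξ (stdVec j) := by
  have hF0 : HasDerivAt F F' (normSq (ξ + (0 : ℝ) • stdVec j)) := by simpa using hF
  exact HasDerivAt.scomp (0 : ℝ) hF0 (hasDerivAt_normSq j ξ)

theorem hasLineDerivAt_coord_smul_radial {F : ℝ → Op} {F' : Op} {ξ : ℝ × ℝ}
    (hF : HasDerivAt F F' (normSq ξ)) (i j : Fin 2) :
    HasLineDerivAt ℝ (fun η => coord i η • F (normSq η))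
      ((if i = j then (1 : ℝ) else 0) • F (normSq ξ) + (coord i ξ * (2 * coord j ξ)) • F')
      ξ (stdVec j) := by
  have h := HasDerivAt.fun_smul (hasDerivAt_coord i j ξ) (hasLineDerivAt_radial hF j)
  refine HasDerivAt.congr_deriv h ?_
  simp only [zero_smul, add_zero, smul_smul]
  rw [add_comm]

theorem pd_radial {F : ℝ → Op} {F' : Op} {ξ : ℝ × ℝ}
    (hF : HasDerivAt F F' (normSq ξ)) (j : Fin 2) :
    pd j (fun η => F (normSq η)) ξ = (2 * coord j ξ) • F' :=
  (hasLineDerivAt_radial hF j).lineDeriv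

theorem pd_const_mul_coord_smul_radial {F : ℝ → Op} {F' : Op} {ξ : ℝ × ℝ}
    (hF : HasDerivAt F F' (normSq ξ)) (c : ℝ) (i j : Fin 2) :
    pd j (fun η => (c * coord i η) • F (normSq η)) ξ =
      c • ((if i = j then (1 : ℝ) else 0) • F (normSq ξ)
        + (coord i ξ * (2 * coord j ξ)) • F') := by
  have h : HasLineDerivAt ℝ (fun η => c • (coord i η • F (normSq η))) _ ξ (stdVec j) :=
    HasDerivAt.const_smul c (hasLineDerivAt_coord_smul_radial hF i j)
  simp only [smul_smul] at h
  exact h.lineDeriv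

theorem pd_sum_coord_smul_radial {F : Fin 2 → ℝ → Op} {F' : Fin 2 → Op} {ξ : ℝ × ℝ}
    (hF : ∀ i, HasDerivAt (F i) (F' i) (normSq ξ)) (j : Fin 2) :
    pd j (fun η => ∑ i, coord i η • F i (normSq η)) ξ =
      F j (normSq ξ) + ∑ i, (coord i ξ * (2 * coord j ξ)) • F' i := by
  have h : HasLineDerivAt ℝ (fun η => ∑ i, coord i η • F i (normSq η)) _ ξ (stdVec j) :=
    HasDerivAt.fun_sum (u := Finset.univ)
      fun (i : Fin 2) _ => hasLineDerivAt_coord_smul_radial (hF i) i j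
  refine h.lineDeriv.trans ?_
  rw [Finset.sum_add_distrib]
  simp

end PartialDerivatives

/-! ### The composition formula in degrees 0, 1, 2. -/

section Composition

theorem comp_zero (b a : ℕ → Sym) (ξ : ℝ × ℝ) (u : ℝ) :
    comp b a 0 ξ u = b 0 ξ u * a 0 ξ u := by
  simp [comp, Finset.sum, Finset.Nat.antidiagonalTuple, Multiset.Nat.antidiagonalTuple,
    List.Nat.antidiagonalTuple]

theorem comp_one (b a : ℕ → Sym) (ξ : ℝ × ℝ) (u : ℝ) :
    comp b a 1 ξ u = b 1 ξ u * a 0 ξ u + b 0 ξ u * a 1 ξ u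
      + pd 0 (fun η => b 0 η u) ξ * δ 0 (a 0 ξ u) + pd 1 (fun η => b 0 η u) ξ * δ 1 (a 0 ξ u) := by
  simp [comp, Finset.sum, Finset.Nat.antidiagonalTuple, Multiset.Nat.antidiagonalTuple,
    List.Nat.antidiagonalTuple]
  abel

/-- The weights `1/2` are the `1/2!` of the pure second derivatives; the mixed derivative has weight
1. Hence `4q` in `coeffQ` but `8q` in `coeffN`. -/
theorem comp_two (b a : ℕ → Sym) (ξ : ℝ × ℝ) (u : ℝ) :
    comp b a 2 ξ u = b 2 ξ u * a 0 ξ u + b 1 ξ u * a 1 ξ u + b 0 ξ u * a 2 ξ u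
      + pd 0 (fun η => b 1 η u) ξ * δ 0 (a 0 ξ u) + pd 1 (fun η => b 1 η u) ξ * δ 1 (a 0 ξ u)
      + pd 0 (fun η => b 0 η u) ξ * δ 0 (a 1 ξ u) + pd 1 (fun η => b 0 η u) ξ * δ 1 (a 1 ξ u)
      + (1 / 2 : ℝ) • (pd 0 (pd 0 (fun η => b 0 η u)) ξ * δ 0 (δ 0 (a 0 ξ u)))
      + (1 / 2 : ℝ) • (pd 1 (pd 1 (fun η => b 0 η u)) ξ * δ 1 (δ 1 (a 0 ξ u)))
      + pd 0 (pd 1 (fun η => b 0 η u)) ξ * δ 0 (δ 1 (a 0 ξ u)) := by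
  simp [comp, Finset.sum, Finset.Nat.antidiagonalTuple, Multiset.Nat.antidiagonalTuple,
    List.Nat.antidiagonalTuple]
  abel

variable {k : Op}

theorem δ_lapSym_zero (hk : ContDiff ℝ ∞ (fun s => act s k)) (j : Fin 2) (ξ : ℝ × ℝ) (u : ℝ) :
    δ j (lapSym k 0 ξ u) = normSq ξ • δ j (k ^ 2) := by
  have h2 : ContDiff ℝ ∞ (fun s => act s (k ^ 2)) := by
    rw [pow_two]; exact contDiff_act_mul hk hk
  have h1 : ContDiff ℝ ∞ (fun s => act s (1 : Op)) := by
    simp only [act_one]; exact contDiff_const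
  simp only [lapSym]
  rw [δ_add (contDiff_act_smul h2 _) (contDiff_act_smul h1 _), δ_smul h2, δ_smul h1, δ_one,
    smul_zero, add_zero, normSq]

theorem δ_lapSym_one (hk : ContDiff ℝ ∞ (fun s => act s k)) (i : Fin 2) (ξ : ℝ × ℝ) (u : ℝ) :
    δ i (lapSym k 1 ξ u) = ∑ j : Fin 2, (2 * coord j ξ) • δ i (k * δ j k) := by
  have h : ∀ j, ContDiff ℝ ∞ (fun s => act s (k * δ j k)) :=
    fun j => contDiff_act_mul hk (contDiff_act_δ hk j)
  simp only [lapSym, Fin.sum_univ_two]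
  rw [δ_add (contDiff_act_smul (h 0) _) (contDiff_act_smul (h 1) _), δ_smul (h 0), δ_smul (h 1)]

end Composition

/-! ### Invertibility of `q a² + 1` and decay of its inverse. -/

section Positivity

/-- For self-adjoint `a` the inner product equals `q‖ax‖² + ‖x‖²`. This coercivity yields both
invertibility and the bound 1 on the inverse. -/
theorem norm_sq_le_norm_inner {a : Op} (ha : IsSelfAdjoint a) {q : ℝ} (hq : 0 ≤ q) (x : Hilb) :
    ‖x‖ ^ 2 ≤ ‖inner ℂ ((q • a ^ 2 + 1 : Op) x) x‖ := by
  have h1 : inner ℂ (a (a x)) x = inner ℂ (a x) (a x) := by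
    rw [← ContinuousLinearMap.adjoint_inner_right, ha.adjoint_eq]
  have e : (q • a ^ 2 + 1 : Op) x = (q : ℂ) • a (a x) + x := by
    rw [pow_two]
    rfl
  rw [e, inner_add_left, inner_smul_left, h1, inner_self_eq_norm_sq_to_K,
    inner_self_eq_norm_sq_to_K, Complex.conj_ofReal]
  have e2 : (q : ℂ) * ((‖a x‖ : ℝ) : ℂ) ^ 2 + ((‖x‖ : ℝ) : ℂ) ^ 2 =
      ((q * ‖a x‖ ^ 2 + ‖x‖ ^ 2 : ℝ) : ℂ) := by push_cast; rfl
  have e3 := congrArg norm e2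
  rw [Complex.norm_of_nonneg (by positivity)] at e3
  refine le_trans ?_ e3.ge
  nlinarith [sq_nonneg ‖a x‖]

/-- For self-adjoint `a`, `q a² + 1` is invertible if `q ≥ 0`. -/
theorem isUnit_smul_sq_add_one {a : Op} (ha : IsSelfAdjoint a) {q : ℝ} (hq : 0 ≤ q) :
    IsUnit (q • a ^ 2 + 1) :=
  ContinuousLinearMap.isUnit_of_forall_le_norm_inner_map _ one_pos fun x => by
    rw [NNReal.coe_one, mul_one]
    exact norm_sq_le_norm_inner ha hq x

theorem norm_res_sq_le {a : Op} (ha : IsSelfAdjoint a) {q : ℝ} (hq : 0 ≤ q) :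
    ‖res (a ^ 2) q‖ ≤ 1 := by
  refine ContinuousLinearMap.opNorm_le_bound _ zero_le_one fun y => ?_
  have h := norm_sq_le_norm_inner ha hq (res (a ^ 2) q y)
  have e : (q • a ^ 2 + 1 : Op) (res (a ^ 2) q y) = y :=
    congrArg (fun T : Op => T y) (Ring.mul_inverse_cancel _ (isUnit_smul_sq_add_one ha hq))
  rw [e] at h
  have h2 := h.trans (norm_inner_le_norm y _)
  rcases (norm_nonneg (res (a ^ 2) q y)).eq_or_lt with h0 | h0
  · rw [← h0]
    positivity
  · nlinarith

/-- Invertibility of `a` gives `q res = a⁻² (1 - res)`, which is bounded because `‖res‖ ≤ 1`; adding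
the bound on `res` itself controls `(1 + q)‖res‖`. -/
theorem decay_res_sq {a : Op} (ha : IsSelfAdjoint a) (hu : IsUnit a) :
    Decay 1 (res (a ^ 2)) := by
  obtain ⟨v, hv⟩ := hu.pow 2
  refine ⟨1 + ‖((v⁻¹ : Opˣ) : Op)‖ * (‖(1 : Op)‖ + 1), fun q hq => ?_⟩
  have h1 := norm_res_sq_le ha hq
  have h2 : q • res (a ^ 2) q = ((v⁻¹ : Opˣ) : Op) * (1 - res (a ^ 2) q) := by
    have h3 : (q • a ^ 2 + 1) * res (a ^ 2) q = 1 :=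
      Ring.mul_inverse_cancel _ (isUnit_smul_sq_add_one ha hq)
    have h4 : (1 : Op) - res (a ^ 2) q = v * (q • res (a ^ 2) q) := by
      rw [hv, mul_smul_comm, ← smul_mul_assoc, sub_eq_iff_eq_add, ← h3, add_mul, one_mul]
    rw [h4, Units.inv_mul_cancel_left]
  have h5 : q * ‖res (a ^ 2) q‖ ≤ ‖((v⁻¹ : Opˣ) : Op)‖ * (‖(1 : Op)‖ + 1) := by
    calc q * ‖res (a ^ 2) q‖ = ‖q • res (a ^ 2) q‖ := by
          rw [norm_smul, Real.norm_of_nonneg hq]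
      _ ≤ ‖((v⁻¹ : Opˣ) : Op)‖ * ‖1 - res (a ^ 2) q‖ := by rw [h2]; exact norm_mul_le _ _
      _ ≤ _ := by
          gcongr
          exact (norm_sub_le _ _).trans (by gcongr)
  rw [pow_one, add_mul, one_mul]
  exact add_le_add h1 h5

end Positivity

/-! ### Solving for `b₀`, `b₁`, `b₂`. -/

section Parametrix

variable {θ : ℝ} {k : Op} {b : ℕ → Sym}

theorem lapSym_zero_one (k : Op) (ξ : ℝ × ℝ) : lapSym k 0 ξ 1 = normSq ξ • k ^ 2 + 1 := by
  simp only [lapSym, one_smul, normSq]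

theorem isUnit_normSq (hsa : IsSelfAdjoint k) (ξ : ℝ × ℝ) : IsUnit (normSq ξ • k ^ 2 + 1) :=
  isUnit_smul_sq_add_one hsa (normSq_nonneg ξ)

theorem mul_res_normSq (hsa : IsSelfAdjoint k) (ξ : ℝ × ℝ) :
    (normSq ξ • k ^ 2 + 1) * res (k ^ 2) (normSq ξ) = 1 :=
  Ring.mul_inverse_cancel _ (isUnit_normSq hsa ξ)

/-- Solving `c (k² |ξ|² + 1) + d = 0` for `c`. -/
theorem eq_neg_mul_res (hsa : IsSelfAdjoint k) {ξ : ℝ × ℝ} {c d : Op}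
    (h : c * (normSq ξ • k ^ 2 + 1) + d = 0) : c = -d * res (k ^ 2) (normSq ξ) := by
  rw [← eq_neg_of_add_eq_zero_left h, mul_assoc, mul_res_normSq hsa, mul_one]

theorem parametrix_zero (hb : IsParametrix θ k b) (hsa : IsSelfAdjoint k) (ξ : ℝ × ℝ) :
    b 0 ξ 1 = res (k ^ 2) (normSq ξ) := by
  have h := hb.inverse 0 ξ 1 one_pos
  rw [comp_zero, lapSym_zero_one] at h
  rw [← mul_one (b 0 ξ 1), ← mul_res_normSq hsa ξ, ← mul_assoc, h, oneSym, one_mul]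

theorem parametrix_one (hb : IsParametrix θ k b) (hk : ContDiff ℝ ∞ (fun s => act s k))
    (hsa : IsSelfAdjoint k) (ξ : ℝ × ℝ) :
    b 1 ξ 1 = ∑ j, coord j ξ • coeffB (k ^ 2) (k * δ j k) (δ j (k ^ 2)) (normSq ξ) := by
  have h := hb.inverse 1 ξ 1 one_pos
  have hu := isUnit_normSq hsa ξ
  rw [comp_one, lapSym_zero_one] at h
  simp only [← lapSym_zero_one, parametrix_zero hb hsa, δ_lapSym_zero hk,
    pd_radial (hasDerivAt_res hu)] at h
  rw [lapSym_zero_one] at h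
  simp only [lapSym, oneSym, Fin.sum_univ_two] at h
  rw [add_assoc, add_assoc] at h
  rw [eq_neg_mul_res hsa h]
  simp only [coeffB, Fin.sum_univ_two, mul_add, add_mul, neg_mul, neg_add, smul_mul_assoc,
    mul_smul_comm, mul_assoc]
  module

theorem parametrix_two (hb : IsParametrix θ k b) (hk : ContDiff ℝ ∞ (fun s => act s k))
    (hsa : IsSelfAdjoint k) (x y : ℝ) :
    b 2 (x, y) 1 =
      -(coeffP (k ^ 2) (∑ j, k * δ j (δ j k)) (fun j => k * δ j k) (fun j => δ j (k ^ 2))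
          (∑ j, δ j (δ j (k ^ 2))) (x ^ 2 + y ^ 2)
        + (x ^ 2) • coeffQ (k ^ 2) (k * δ 0 k) (δ 0 (k ^ 2)) (δ 0 (k * δ 0 k))
            (δ 0 (δ 0 (k ^ 2))) (x ^ 2 + y ^ 2)
        + (y ^ 2) • coeffQ (k ^ 2) (k * δ 1 k) (δ 1 (k ^ 2)) (δ 1 (k * δ 1 k))
            (δ 1 (δ 1 (k ^ 2))) (x ^ 2 + y ^ 2)
        + (x * y) • coeffN (k ^ 2) (fun j => k * δ j k) (fun j => δ j (k ^ 2))
            (δ 0 (k * δ 1 k) + δ 1 (k * δ 0 k)) (δ 0 (δ 1 (k ^ 2))) (x ^ 2 + y ^ 2))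
      * res (k ^ 2) (x ^ 2 + y ^ 2) := by
  set ξ : ℝ × ℝ := (x, y)
  have h := hb.inverse 2 ξ 1 one_pos
  have hu := isUnit_normSq hsa ξ
  have h2 : ContDiff ℝ ∞ (fun s => act s (k ^ 2)) := by
    rw [pow_two]
    exact contDiff_act_mul hk hk
  have hu' := fun η => isUnit_normSq hsa η
  -- Stated as an equality of functions, since the second derivatives of `b₀` differentiate it once
  -- more.
  have hpd : ∀ j, pd j (fun η => res (k ^ 2) (normSq η)) =
      fun η => ((-2) * coord j η) • (k ^ 2 * res (k ^ 2) (normSq η) ^ 2) := fun j => by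
    funext η
    rw [pd_radial (hasDerivAt_res (hu' η))]
    module
  rw [comp_two] at h
  simp only [δ_lapSym_zero hk, δ_smul (contDiff_act_δ h2 _), δ_lapSym_one hk, parametrix_zero hb hsa,
    parametrix_one hb hk hsa, hpd] at h
  simp only [pd_sum_coord_smul_radial (F := fun j => coeffB (k ^ 2) (k * δ j k) (δ j (k ^ 2)))
      fun j => hasDerivAt_coeffB (k * δ j k) (δ j (k ^ 2)) hu,
    pd_const_mul_coord_smul_radial (F := fun q => k ^ 2 * res (k ^ 2) q ^ 2)
      (hasDerivAt_mul_res_sq hu), lapSym_zero_one] at h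
  simp only [add_assoc, oneSym] at h
  have hq : x ^ 2 + y ^ 2 = normSq ξ := (normSq_mk x y).symm
  rw [hq, eq_neg_mul_res hsa h]
  congr 2
  have c0 : coord 0 ξ = x := rfl
  have c1 : coord 1 ξ = y := rfl
  simp only [lapSym, Fin.sum_univ_two, c0, c1, coeffP, coeffQ, coeffN, if_true, one_ne_zero,
    if_false, zero_smul, one_smul]
  -- From here on the resolvent and the coefficients of `b₁` with their derivatives are opaque: the
  -- two sides differ only by regrouping monomials in `x`, `y`.
  generalize normSq ξ = q
  generalize res (k ^ 2) q = β
  generalize coeffB (k ^ 2) (k * δ 0 k) (δ 0 (k ^ 2)) q = B₀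
  generalize coeffB (k ^ 2) (k * δ 1 k) (δ 1 (k ^ 2)) q = B₁
  generalize coeffB' (k ^ 2) (k * δ 0 k) (δ 0 (k ^ 2)) q = B₀'
  generalize coeffB' (k ^ 2) (k * δ 1 k) (δ 1 (k ^ 2)) q = B₁'
  simp only [mul_add, add_mul, neg_mul, zero_add, smul_neg, smul_add, smul_mul_assoc, mul_smul_comm,
    mul_assoc]
  module

end Parametrix

theorem T_eq {k : Op} (hk : ContDiff ℝ ∞ (fun s => act s k)) (r : ℝ) :
    T k r = -(coeffP (k ^ 2) (∑ j, k * δ j (δ j k)) (fun j => k * δ j k) (fun j => δ j (k ^ 2))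
          (∑ j, δ j (δ j (k ^ 2))) (r ^ 2)
        + (r ^ 2 / 2) • (coeffQ (k ^ 2) (k * δ 0 k) (δ 0 (k ^ 2)) (δ 0 (k * δ 0 k))
            (δ 0 (δ 0 (k ^ 2))) (r ^ 2)
          + coeffQ (k ^ 2) (k * δ 1 k) (δ 1 (k ^ 2)) (δ 1 (k * δ 1 k))
            (δ 1 (δ 1 (k ^ 2))) (r ^ 2))) := by
  have h1 : ∀ j, ContDiff ℝ ∞ (fun s => act s (δ j k)) := contDiff_act_δ hk
  have e1 : ∀ j, δ j (k ^ 2) = δ j k * k + k * δ j k := fun j => by rw [pow_two, δ_mul hk hk]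
  have e2 : ∀ j, δ j (k * δ j k) = δ j k * δ j k + k * δ j (δ j k) := fun j => δ_mul hk (h1 j) j
  have e3 : ∀ j, δ j (δ j (k ^ 2)) =
      δ j (δ j k) * k + δ j k * δ j k + (δ j k * δ j k + k * δ j (δ j k)) := fun j => by
    rw [e1, δ_add (contDiff_act_mul (h1 j) hk) (contDiff_act_mul hk (h1 j)), δ_mul (h1 j) hk, e2]
  have e4 : T k r = ∑ i, summandT k (res (k ^ 2) (r ^ 2)) (δ i k) (δ i (δ i k)) r := rfl
  have e5 := fun i => summandT_eq k (δ i k) (δ i (δ i k)) r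
  rw [e4, Fin.sum_univ_two, e5 0, e5 1]
  simp only [e3, Fin.sum_univ_two, coeffP]
  simp only [e1, e2, mul_add, smul_add]
  module

end NCTorus

/-! ### The integral of `b₂`. -/

theorem lemma3p2 (θ : ℝ) (hθ : Irrational θ)
    (h : NCTorus.Op) (hh : h ∈ NCTorus.smooth θ) (hsa : IsSelfAdjoint h)
    (k : NCTorus.Op) (hk : k = NormedSpace.exp ((1 / 2 : ℝ) • h))
    (b : ℕ → NCTorus.Sym) (hb : NCTorus.IsParametrix θ k b) :
    (∀ r φ : ℝ, b 0 (r * Real.cos φ, r * Real.sin φ) 1 = NCTorus.b₀ k r) ∧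
    Integrable (fun ξ : ℝ × ℝ => b 2 ξ 1) ∧
    IntegrableOn (fun r : ℝ => r • (NCTorus.T k r * NCTorus.b₀ k r)) (Ioi 0) ∧
    ∫ ξ : ℝ × ℝ, b 2 ξ 1 =
      (2 * Real.pi) • ∫ r in Ioi (0 : ℝ), r • (NCTorus.T k r * NCTorus.b₀ k r) := by
  open NCTorus in
  have hks : ContDiff ℝ ∞ (fun s => act s k) := by
    rw [hk]
    exact contDiff_act_exp (contDiff_act_smul hh.2 _)
  have hksa : IsSelfAdjoint k := by
    have e : (1 / 2 : ℝ) • h = ((1 / 2 : ℝ) : ℂ) • h := rfl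
    rw [hk, e]
    exact (IsSelfAdjoint.smul (Complex.conj_ofReal _) hsa).exp
  have hku : IsUnit k := by
    let _ : NormedAlgebra ℚ Op := NormedAlgebra.restrictScalars ℚ ℂ Op
    rw [hk]
    exact NormedSpace.isUnit_exp _
  have hdecay := decay_res_sq hksa hku
  have hcont : Continuous (fun ξ : ℝ × ℝ => b 2 ξ 1) := by
    -- Joint smoothness of `α_s(b₂(ξ, u))` is restricted to the slice `u = 1`, `s = 0`.
    have h1 := (hb.symbol 2).contDiff.continuousOn.comp_continuous
      (f := fun ξ : ℝ × ℝ => (ξ, (1 : ℝ), (0 : ℝ × ℝ))) (by fun_prop) (fun _ => one_pos (α := ℝ))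
    simpa only [Function.comp_def, act_zero] using h1
  -- Only the decay orders matter now, together with the fact that `b₂` and `T` involve the same
  -- `P`, `Q₀`, `Q₁`.
  obtain ⟨P, Q₀, Q₁, N, hP, hQ₀, hQ₁, hN, hb2, hT⟩ : ∃ P Q₀ Q₁ N : ℝ → Op,
      Decay 1 P ∧ Decay 2 Q₀ ∧ Decay 2 Q₁ ∧ Decay 2 N ∧
      (∀ x y : ℝ, b 2 (x, y) 1 = -(P (x ^ 2 + y ^ 2) + (x ^ 2) • Q₀ (x ^ 2 + y ^ 2)
        + (y ^ 2) • Q₁ (x ^ 2 + y ^ 2) + (x * y) • N (x ^ 2 + y ^ 2))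
        * res (k ^ 2) (x ^ 2 + y ^ 2)) ∧
      ∀ r : ℝ, T k r = -(P (r ^ 2) + (r ^ 2 / 2) • (Q₀ (r ^ 2) + Q₁ (r ^ 2))) :=
    ⟨_, _, _, _, decay_coeffP hdecay _ _ _ _, decay_coeffQ hdecay _ _ _ _,
      decay_coeffQ hdecay _ _ _ _, decay_coeffN hdecay _ _ _ _,
      parametrix_two hb hks hksa, T_eq hks⟩
  have hform : ∀ x y : ℝ, b 2 (x, y) 1 =
      -(P (x ^ 2 + y ^ 2) * res (k ^ 2) (x ^ 2 + y ^ 2))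
      + (x ^ 2) • -(Q₀ (x ^ 2 + y ^ 2) * res (k ^ 2) (x ^ 2 + y ^ 2))
      + (y ^ 2) • -(Q₁ (x ^ 2 + y ^ 2) * res (k ^ 2) (x ^ 2 + y ^ 2))
      + (x * y) • -(N (x ^ 2 + y ^ 2) * res (k ^ 2) (x ^ 2 + y ^ 2)) := fun x y => by
    rw [hb2]
    simp only [neg_mul, add_mul, smul_mul_assoc]
    module
  -- The right factor `b₀` raises the decay orders from 1 and 2 to the required 2 and 3.
  have hint := integrable_of_decay hcont (fun q => -(P q * res (k ^ 2) q))
    (fun q => -(Q₀ q * res (k ^ 2) q)) (fun q => -(Q₁ q * res (k ^ 2) q))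
    (fun q => -(N q * res (k ^ 2) q)) hform (hP.mul hdecay).neg (hQ₀.mul hdecay).neg
    (hQ₁.mul hdecay).neg (hN.mul hdecay).neg
  have hpolar := integral_polar_of_quadratic hint (fun q => -(P q * res (k ^ 2) q))
    (fun q => -(Q₀ q * res (k ^ 2) q)) (fun q => -(Q₁ q * res (k ^ 2) q))
    (fun q => -(N q * res (k ^ 2) q)) hform
  have hTb : ∀ r : ℝ, T k r * b₀ k r = -(P (r ^ 2) * res (k ^ 2) (r ^ 2))
      + (r ^ 2 / 2) • (-(Q₀ (r ^ 2) * res (k ^ 2) (r ^ 2))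
        + -(Q₁ (r ^ 2) * res (k ^ 2) (r ^ 2))) := fun r => by
    rw [hT, show b₀ k r = res (k ^ 2) (r ^ 2) from rfl]
    simp only [neg_mul, add_mul, smul_mul_assoc]
    module
  simp only [hTb]
  refine ⟨fun r φ => ?_, hint, hpolar⟩
  rw [parametrix_zero hb hksa, normSq_mk, show b₀ k r = res (k ^ 2) (r ^ 2) from rfl]
  congr 1
  linear_combination r ^ 2 * Real.cos_sq_add_sin_sq φ
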